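/- Consider a homogeneous-goods market: a finite set $B$ of buyers, a finite set $S$ of $m$ sellers with one good each, a bipartite graph $G$ of direct links, and values $w_i\ge 0$, buyer $i$ valuing every seller's good at $w_i$ and wanting at most one good. A competitive equilibrium of a network is a pair (prices $p\ge 0$, allocation along links giving each buyer at most one good and selling each good at most once) in which each buyer's utility is nonnegative and at least $w_i-p_j$ for every seller $j$ linked to her, and unsold goods have price $0$; $p$ is then called competitive. For $P\subseteq S$ let $G(P)$ be $G$ with every seller of $P$ linked to all buyers, and let $p(P)$ be the coordinatewise maximum of the competitive price vectors of $G(P)$. For a fee $\alpha\in[0,1]$, $P$ is a pure Platform Equilibrium at $\alpha$ if $(1-\alpha)p_j(P)\ge p_j(P\setminus\{j\})$ for all $j\in P$ and $p_j(P)\ge(1-\alpha)p_j(P\cup\{j\})$ for all $j\notin P$. Put $p_j^{\mathrm{off}}(P)=p_j(P\setminus\{j\})$ and $\phi_j^P(\alpha)=(1-\alpha)\,p_j(P\cup\{j\})-p_j^{\mathrm{off}}(P)$. Algorithm 1 at fee $\alpha$ starts with $P=\emptyset$. While $P\ne S$, it picks a candidate, i.e. a seller $\hat\jmath$ with the smallest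 $p^{\mathrm{off}}_j(P)$ among the maximizers of $\phi_j^P(\alpha)$ over $j\in S\setminus P$ (remaining ties broken arbitrarily); if $\phi_{\hat\jmath}^P(\alpha)\ge 0$ it adds $\hat\jmath$ to $P$ and repeats, and otherwise it stops. It outputs the last $P$. A sweep starts with $\alpha=1$, $P=\emptyset$, and repeatedly does one of the following: it lowers the fee continuously from $\alpha$ to some $\alpha'\in[0,\alpha]$, allowed if $\phi_j^P(\beta)<0$ for all $j\notin P$ and all $\beta\in(\alpha',\alpha]$; or it carries out one iteration of Algorithm 1 at the current fee, adding one candidate of nonnegative gain. **Theorem.** In every homogeneous-goods market the maximum competitive prices $p(P)$ exist for all $P\subseteq S$ and are themselves competitive, and: 1. For every $m_p=1,\dots,m$ there are $\alpha\in[0,1]$ and $P\subseteq S$ with $|P|=m_p$ such that $P$ is a pure Platform Equilibrium at $\alpha$, and such that some sweep reaches $(\alpha,P)$. 2. Whenever a sweep reaches $(\alpha,P)$, the set $P$ is a pure Platform Equilibrium at $\alpha$, $P$ occurs in a run of Algorithm 1 at the fixed fee $\alpha$, and $\phi_j^P(\alpha)\le 0$ for all $j\notin P$. 3. If a sweep reaches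 $(\alpha,P)$ with $P\neq S$, then the fee can be lowered to some $\alpha'\in[0,\alpha]$ such that $(\alpha',P)$ is reached by a sweep, the gain $\phi_{\hat\jmath}^P(\alpha')$ of some candidate $\hat\jmath$ is exactly $0$, and a sweep reaches $(\alpha',P\cup\{\hat\jmath\})$. Thus equilibria of all sizes are found by lowering $\alpha$ from $1$ to $0$ and adding one seller at a time. 4. Every output of Algorithm 1 at any fixed fee $\alpha\in[0,1]$ is reached, at that fee, by a sweep. -/

import Mathlib

noncomputable section

namespace PlatformMarket

variable {Buyer Seller : Type*}

/-- Quasi-linear utility of buyer `i` when she receives the good `x` (`none` means no good). -/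
def buyerUtility (v : Buyer → Seller → ℝ) (p : Seller → ℝ) (i : Buyer) : Option Seller → ℝ
  | none => 0
  | some j => v i j - p j

/-- Competitive (Walrasian) equilibrium `(p, a)` of the unit-demand buyer-seller network `g` with
values `v`. The allocation is recorded by the good `a i` that buyer `i` receives, so that every
buyer gets at most one good by construction. -/
structure IsCompetitiveEquilibrium (v : Buyer → Seller → ℝ) (g : Buyer → Seller → Prop)
    (p : Seller → ℝ) (a : Buyer → Option Seller) : Prop where
  price_nonneg : ∀ j, 0 ≤ p j
  respects_links : ∀ i j, a i = some j → g i j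
  sold_at_most_once : ∀ i i' j, a i = some j → a i' = some j → i = i'
  most_preferred : ∀ i j, g i j → v i j - p j ≤ buyerUtility v p i (a i)
  utility_nonneg : ∀ i, 0 ≤ buyerUtility v p i (a i)
  unsold_price_zero : ∀ j, (∀ i, a i ≠ some j) → p j = 0

/-- Competitive price vectors: those that belong to some competitive equilibrium. -/
def IsCompetitivePrice (v : Buyer → Seller → ℝ) (g : Buyer → Seller → Prop)
    (p : Seller → ℝ) : Prop :=
  ∃ a, IsCompetitiveEquilibrium v g p a

/-- The maximum competitive prices (coordinatewise supremum of the competitive prices). -/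
def maxPrice (v : Buyer → Seller → ℝ) (g : Buyer → Seller → Prop) (j : Seller) : ℝ :=
  sSup {x | ∃ p, IsCompetitivePrice v g p ∧ p j = x}

/-- The network `G(P)`: sellers in `P` are linked to all buyers, other links are unchanged. -/
def platformGraph (g : Buyer → Seller → Prop) (P : Finset Seller) : Buyer → Seller → Prop :=
  fun i j => j ∈ P ∨ g i j

/-- The prices `p(P)` at which the market clears when the set `P` of sellers is on the platform. -/
def platformPrice (v : Buyer → Seller → ℝ) (g : Buyer → Seller → Prop) (P : Finset Seller)
    (j : Seller) : ℝ :=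
  maxPrice v (platformGraph g P) j

/-- Values in a homogeneous-goods market: buyer `i` values every good at `w i`. -/
def homogeneousValue (w : Buyer → ℝ) : Buyer → Seller → ℝ := fun i _ => w i

variable [DecidableEq Seller]

/-- `P` is a pure Platform Equilibrium at the transaction fee `α`. -/
def IsPurePlatformEquilibrium (v : Buyer → Seller → ℝ) (g : Buyer → Seller → Prop) (α : ℝ)
    (P : Finset Seller) : Prop :=
  (∀ j ∈ P, platformPrice v g (P.erase j) j ≤ (1 - α) * platformPrice v g P j) ∧
    ∀ j ∉ P, (1 - α) * platformPrice v g (insert j P) j ≤ platformPrice v g P j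

/-- `j`'s price when `j` joins and the sellers in `P \ {j}` are on the platform. -/
def onPrice (v : Buyer → Seller → ℝ) (g : Buyer → Seller → Prop) (P : Finset Seller)
    (j : Seller) : ℝ :=
  platformPrice v g (insert j P) j

/-- `j`'s price when `j` stays off and the sellers in `P \ {j}` are on the platform. -/
def offPrice (v : Buyer → Seller → ℝ) (g : Buyer → Seller → Prop) (P : Finset Seller)
    (j : Seller) : ℝ :=
  platformPrice v g (P.erase j) j

/-- The gain `φ_j^P` of seller `j` from joining the platform at the fee `α`. -/
def gain (v : Buyer → Seller → ℝ) (g : Buyer → Seller → Prop) (α : ℝ) (P : Finset Seller)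
    (j : Seller) : ℝ :=
  (1 - α) * onPrice v g P j - offPrice v g P j

/-- `j` is a candidate of the algorithm at `P`: it maximizes the gain among the sellers outside
`P`, and has the lowest off-platform price among these maximizers. -/
def IsCandidate (v : Buyer → Seller → ℝ) (g : Buyer → Seller → Prop) (α : ℝ)
    (P : Finset Seller) (j : Seller) : Prop :=
  j ∉ P ∧ (∀ j' ∉ P, gain v g α P j' ≤ gain v g α P j) ∧
    ∀ j' ∉ P, gain v g α P j' = gain v g α P j → offPrice v g P j ≤ offPrice v g P j'

/-- One iteration of the algorithm at the fee `α`: a candidate whose gain is nonnegative is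
added. (Ties between candidates are broken arbitrarily.) -/
def AlgStep (v : Buyer → Seller → ℝ) (g : Buyer → Seller → Prop) (α : ℝ)
    (P Q : Finset Seller) : Prop :=
  ∃ j, IsCandidate v g α P j ∧ 0 ≤ gain v g α P j ∧ Q = insert j P

/-- `P` occurs during some run, from the empty set, of the algorithm at the fixed fee `α`. -/
def AlgVisits (v : Buyer → Seller → ℝ) (g : Buyer → Seller → Prop) (α : ℝ)
    (P : Finset Seller) : Prop :=
  Relation.ReflTransGen (AlgStep v g α) ∅ P

/-- `P` is the output of some run of the algorithm at the fixed fee `α`. -/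
def AlgOutputs (v : Buyer → Seller → ℝ) (g : Buyer → Seller → Prop) (α : ℝ)
    (P : Finset Seller) : Prop :=
  AlgVisits v g α P ∧ ¬ ∃ Q, AlgStep v g α P Q

/-- `SweepReaches v g α P`: some sweep, which starts with fee `1` and no seller on the platform,
reaches the fee `α` with the set `P` on the platform. The fee may be lowered from `α` to `α'` if
every seller outside `P` has a negative gain at each fee strictly above `α'` that is passed; an
iteration of the algorithm may be carried out at the current fee. -/
inductive SweepReaches (v : Buyer → Seller → ℝ) (g : Buyer → Seller → Prop) :
    ℝ → Finset Seller → Prop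
  | start : SweepReaches v g 1 ∅
  | lower {α α' : ℝ} {P : Finset Seller} : SweepReaches v g α P → 0 ≤ α' → α' ≤ α →
      (∀ β, α' < β → β ≤ α → ∀ j ∉ P, gain v g β P j < 0) → SweepReaches v g α' P
  | add {α : ℝ} {P Q : Finset Seller} : SweepReaches v g α P → AlgStep v g α P Q →
      SweepReaches v g α Q

end PlatformMarket

end

/-! All goods are alike to a buyer, so the weight of a matching depends only on which buyers are
matched. Let `V T` be the largest weight of a matching into the seller set `T`. By duality, the
maximum competitive price of a seller is her marginal contribution to `V`.

Two exchange inequalities, both proved by swapping two optimal matchings along an alternating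
component, carry the argument. Sellers are substitutes (`optWeight_insert_insert_add_le`), and two
sellers with different marginals over `F` do not compete at all: their marginals add up
(`optWeight_insert_add_insert_le`). The second one fails for general unit-demand values.

Joining the platform is modelled by replacing a seller's copy with her own links by a copy linked to
all buyers, so that all prices become marginals of one function `V`. It follows that the price on
the platform is `max (off price) c` with `c` common to all outsiders (`exists_onPrice_eq_max`).
Hence the gain is antitone in the off price, and the candidates are the outsiders of lowest off
price, at every fee (`isCandidate_iff`).

A sweep therefore adds sellers in an order that does not depend on the fee. Let `π` and `q` be the
off and on prices of the last joiner, who was indifferent: `(1 - α₀) * q = π`. Members have off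
price at most `π` and on price `q`; outsiders have off price at least `π` and on price at most `q`.
These bounds (`SweepInvariant`) survive each step and give the equilibrium inequalities. -/

namespace PlatformMarket

/-! ### Optimal matchings and the two exchange inequalities. -/

section Matching

variable {Buyer τ : Type*}

/-- `a` is a matching of the buyers along the network `h` to the sellers in `T`, each of whom is
used at most once. -/
structure IsMatching (h : Buyer → τ → Prop) (T : Finset τ) (a : Buyer → Option τ) : Prop where
  mem : ∀ i s, a i = some s → s ∈ T
  link : ∀ i s, a i = some s → h i s
  inj : ∀ i i' s, a i = some s → a i' = some s → i = i'

open Classical in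
/-- Total value of the matched buyers. -/
noncomputable def matchWeight [Fintype Buyer] (w : Buyer → ℝ) (a : Buyer → Option τ) : ℝ :=
  ∑ i, if (a i).isSome then w i else 0

/-- Largest total value of the matched buyers in a matching to `T`. -/
noncomputable def optWeight [Fintype Buyer] (h : Buyer → τ → Prop) (w : Buyer → ℝ)
    (T : Finset τ) : ℝ :=
  sSup {x | ∃ a, IsMatching h T a ∧ matchWeight w a = x}

variable {h : Buyer → τ → Prop} {T : Finset τ} {a b : Buyer → Option τ}

theorem isMatching_none : IsMatching h T (fun _ => none) where
  mem _ _ e := by simp at e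
  link _ _ e := by simp at e
  inj _ _ _ e := by simp at e

theorem IsMatching.mono {T' : Finset τ} (ha : IsMatching h T a)
    (hT : ∀ i s, a i = some s → s ∈ T') : IsMatching h T' a :=
  ⟨hT, ha.link, ha.inj⟩

open Classical in
/-- Exchanging two matchings on a set `C` of buyers and `D` of sellers closed under both. -/
theorem IsMatching.piecewise {T₁ T₂ T' : Finset τ} (ha : IsMatching h T₁ a)
    (hb : IsMatching h T₂ b) {C : Set Buyer} {D : Set τ}
    (hCa : ∀ i s, a i = some s → (i ∈ C ↔ s ∈ D)) (hCb : ∀ i s, b i = some s → (i ∈ C ↔ s ∈ D))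
    (ha' : ∀ s ∈ T₁, s ∈ D → s ∈ T') (hb' : ∀ s ∈ T₂, s ∉ D → s ∈ T') :
    IsMatching h T' (C.piecewise a b) := by
  refine ⟨fun i s e => ?_, fun i s e => ?_, fun i i' s e e' => ?_⟩
  · by_cases hi : i ∈ C <;> simp only [Set.piecewise, hi, if_true, if_false] at e
    · exact ha' s (ha.mem i s e) ((hCa i s e).1 hi)
    · exact hb' s (hb.mem i s e) fun hs => hi ((hCb i s e).2 hs)
  · by_cases hi : i ∈ C <;> simp only [Set.piecewise, hi, if_true, if_false] at e
    · exact ha.link i s e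
    · exact hb.link i s e
  · by_cases hi : i ∈ C <;> by_cases hi' : i' ∈ C <;>
      simp only [Set.piecewise, hi, hi', if_true, if_false] at e e'
    · exact ha.inj i i' s e e'
    · exact absurd ((hCb i' s e').2 ((hCa i s e).1 hi)) hi'
    · exact absurd ((hCb i s e).2 ((hCa i' s e').1 hi')) hi
    · exact hb.inj i i' s e e'

/-- The component of `x` in the union of two matchings, one of which misses `x`. -/
theorem exists_component {T' : Finset τ} (a : Buyer → Option τ) (hb : IsMatching h T' b) (x : τ)
    (hx : ∀ i, b i ≠ some x) :
    ∃ (C : Set Buyer) (D : Set τ), x ∈ D ∧ (∀ i s, a i = some s → (i ∈ C ↔ s ∈ D)) ∧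
      (∀ i s, b i = some s → (i ∈ C ↔ s ∈ D)) ∧ (∀ i ∈ C, ∃ s, a i = some s) ∧
      ∀ t ∈ D, t ≠ x → ∃ i, b i = some t := by
  set r : τ → τ → Prop := fun s t => ∃ i, a i = some s ∧ b i = some t
  set D : Set τ := {s | Relation.ReflTransGen r x s}
  have hD : ∀ t ∈ D, t ≠ x → ∃ i s, a i = some s ∧ s ∈ D ∧ b i = some t := by
    intro t ht hne
    rcases Relation.ReflTransGen.cases_tail ht with e | ⟨s, hs, i, h1, h2⟩
    · exact absurd e hne
    · exact ⟨i, s, h1, hs, h2⟩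
  refine ⟨{i | ∃ s ∈ D, a i = some s}, D, .refl, fun i s e => ?_, fun i t e => ?_, ?_, ?_⟩
  · simp [e]
  · constructor
    · rintro ⟨s, hs, e'⟩
      exact Relation.ReflTransGen.tail hs ⟨i, e', e⟩
    · intro ht
      obtain ⟨i', s, h1, h2, h3⟩ := hD t ht (by rintro rfl; exact hx i e)
      obtain rfl := hb.inj i i' t e h3
      exact ⟨s, h2, h1⟩
  · rintro i ⟨s, -, e⟩
    exact ⟨s, e⟩
  · intro t ht hne
    obtain ⟨i, -, -, -, h3⟩ := hD t ht hne
    exact ⟨i, h3⟩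

/-- Relabelling the sellers. -/
theorem IsMatching.map {σ : Type*} {h' : Buyer → σ → Prop} {T' : Finset σ}
    (ha : IsMatching h T a) (e : τ → σ) (he : Set.InjOn e T) (hl : ∀ i, ∀ s ∈ T, h i s → h' i (e s))
    (hT : ∀ s ∈ T, e s ∈ T') : IsMatching h' T' (fun i => (a i).map e) := by
  refine ⟨fun i s hs => ?_, fun i s hs => ?_, fun i i' s hs hs' => ?_⟩
  · obtain ⟨t, ht, rfl⟩ := Option.map_eq_some_iff.1 hs
    exact hT t (ha.mem i t ht)
  · obtain ⟨t, ht, rfl⟩ := Option.map_eq_some_iff.1 hs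
    exact hl i t (ha.mem i t ht) (ha.link i t ht)
  · obtain ⟨t, ht, rfl⟩ := Option.map_eq_some_iff.1 hs
    obtain ⟨t', ht', e'⟩ := Option.map_eq_some_iff.1 hs'
    obtain rfl := he (ha.mem i' t' ht') (ha.mem i t ht) e'
    exact ha.inj i i' t' ht ht'

variable [Fintype Buyer] {w : Buyer → ℝ}

theorem finite_matchWeight :
    {x | ∃ a, IsMatching h T a ∧ matchWeight w a = x}.Finite := by
  classical
  refine (Set.finite_range fun X : Finset Buyer => ∑ i ∈ X, w i).subset ?_
  rintro _ ⟨a, -, rfl⟩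
  exact ⟨Finset.univ.filter fun i => (a i).isSome, by simp [matchWeight, Finset.sum_filter]⟩

theorem IsMatching.le_optWeight (ha : IsMatching h T a) : matchWeight w a ≤ optWeight h w T :=
  le_csSup finite_matchWeight.bddAbove ⟨a, ha, rfl⟩

theorem exists_isMatching_eq_optWeight (h : Buyer → τ → Prop) (w : Buyer → ℝ) (T : Finset τ) :
    ∃ a, IsMatching h T a ∧ matchWeight w a = optWeight h w T :=
  Set.Nonempty.csSup_mem (s := {x | ∃ a, IsMatching h T a ∧ matchWeight w a = x})
    ⟨_, _, isMatching_none, rfl⟩ finite_matchWeight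

theorem optWeight_mono {T' : Finset τ} (hT : T ⊆ T') : optWeight h w T ≤ optWeight h w T' := by
  obtain ⟨a, ha, e⟩ := exists_isMatching_eq_optWeight h w T
  exact e ▸ (ha.mono fun i s hs => hT (ha.mem i s hs)).le_optWeight

open Classical in
theorem matchWeight_piecewise_add (C : Set Buyer) :
    matchWeight w (C.piecewise a b) + matchWeight w (C.piecewise b a) =
      matchWeight w a + matchWeight w b := by
  simp only [matchWeight, ← Finset.sum_add_distrib]
  refine Finset.sum_congr rfl fun i _ => ?_
  by_cases hi : i ∈ C <;> simp [Set.piecewise, hi, add_comm]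

-- This is where homogeneity enters: changing which good a matched buyer receives costs nothing.
open Classical in
theorem matchWeight_piecewise (C : Set Buyer) (hC : ∀ i ∈ C, (a i).isSome ∧ (b i).isSome) :
    matchWeight w (C.piecewise a b) = matchWeight w b := by
  refine Finset.sum_congr rfl fun i _ => ?_
  by_cases hi : i ∈ C
  · simp [Set.piecewise, hi, (hC i hi).1, (hC i hi).2]
  · simp [Set.piecewise, hi]

theorem optWeight_le_of_injOn {σ : Type*} {h' : Buyer → σ → Prop} {T' : Finset σ} (e : τ → σ)
    (he : Set.InjOn e T) (hl : ∀ i, ∀ s ∈ T, h i s → h' i (e s)) (hT : ∀ s ∈ T, e s ∈ T') :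
    optWeight h w T ≤ optWeight h' w T' := by
  obtain ⟨a, ha, ea⟩ := exists_isMatching_eq_optWeight h w T
  have := (ha.map e he hl hT).le_optWeight (w := w)
  rw [← ea]
  simpa [matchWeight] using this

variable [DecidableEq τ]

/-- Sellers are substitutes. -/
theorem optWeight_insert_insert_add_le {F : Finset τ} {x y : τ} (hx : x ∉ F) (hy : y ∉ F)
    (hxy : x ≠ y) :
    optWeight h w (insert x (insert y F)) + optWeight h w F ≤
      optWeight h w (insert x F) + optWeight h w (insert y F) := by
  classical
  obtain ⟨a, ha, ea⟩ := exists_isMatching_eq_optWeight h w (insert x (insert y F))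
  obtain ⟨b, hb, eb⟩ := exists_isMatching_eq_optWeight h w F
  obtain ⟨C, D, hxD, hCa, hCb, -, hD⟩ :=
    exists_component a hb x fun i e => hx (hb.mem i x e)
  -- Sellers of the component other than `x` are matched by `b`, hence lie in `F`; so the swap
  -- leaves `y` with `a`.
  have hyD : y ∉ D := fun hyD => by
    obtain ⟨i, e⟩ := hD y hyD hxy.symm
    exact hy (hb.mem i y e)
  rw [← ea, ← eb, ← matchWeight_piecewise_add C]
  refine add_le_add (IsMatching.le_optWeight ?_) (IsMatching.le_optWeight ?_)
  · refine ha.piecewise hb hCa hCb (fun s hs hsD => ?_) fun s hs _ => Finset.mem_insert_of_mem hs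
    have : s ≠ y := fun e => hyD (e ▸ hsD)
    simp only [Finset.mem_insert] at hs ⊢
    tauto
  · refine hb.piecewise ha hCb hCa (fun s hs _ => Finset.mem_insert_of_mem hs) fun s hs hsD => ?_
    have : s ≠ x := fun e => hsD (e ▸ hxD)
    simp only [Finset.mem_insert] at hs ⊢
    tauto

/-- The marginal weights of two sellers with different marginal weights add up. -/
theorem optWeight_insert_add_insert_le {F : Finset τ} {x y : τ} (hx : x ∉ F) (hy : y ∉ F)
    (hxy : x ≠ y) (hlt : optWeight h w (insert y F) < optWeight h w (insert x F)) :
    optWeight h w (insert x F) + optWeight h w (insert y F) ≤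
      optWeight h w (insert x (insert y F)) + optWeight h w F := by
  classical
  obtain ⟨a, ha, ea⟩ := exists_isMatching_eq_optWeight h w (insert x F)
  obtain ⟨b, hb, eb⟩ := exists_isMatching_eq_optWeight h w (insert y F)
  obtain ⟨C, D, hxD, hCa, hCb, hC, hD⟩ := exists_component a hb x fun i e => by
    have := hb.mem i x e
    simp [hx, hxy] at this
  by_cases hyD : y ∈ D
  -- Here the alternating path runs from `x` to `y`. Counting shows that both matchings cover all
  -- its buyers, so `a` can be rerouted along it to use `y` instead of `x` at equal weight, against
  -- `hlt`.
  · exfalso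
    have hDsub : D ⊆ (insert x (insert y F) : Finset τ) := fun t ht => by
      by_cases htx : t = x
      · simp [htx]
      · obtain ⟨i, e⟩ := hD t ht htx
        exact Finset.mem_coe.2 (Finset.mem_insert_of_mem (hb.mem i t e))
    lift D to Finset τ using (Finset.finite_toSet _).subset hDsub
    simp only [Finset.mem_coe] at hxD hCa hCb hD hyD
    have hbC : ∀ i ∈ C, ∃ t, b i = some t := by
      -- `a` injects `C` into `D` without `y`, and `D` without `x` injects into the buyers that `b`
      -- matches in `D`, who lie in `C`. The two erased sets have equal size, so all inclusions are
      -- equalities.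
      have h1 : (Finset.univ.filter (· ∈ C)).card ≤ (D.erase y).card := by
        have : Nonempty τ := ⟨x⟩
        choose! f hf using hC
        refine Finset.card_le_card_of_injOn f (fun i hi => ?_) fun i hi i' hi' e => ?_
        · simp only [Finset.coe_filter, Finset.mem_univ, true_and, Set.mem_ofPred_eq] at hi
          have := ha.mem i _ (hf i hi)
          have hne : f i ≠ y := by
            intro e
            rw [e] at this
            simp [hy, hxy.symm] at this
          simp [hne, (hCa i _ (hf i hi)).1 hi]
        · simp only [Finset.coe_filter, Finset.mem_univ, true_and, Set.mem_ofPred_eq] at hi hi'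
          exact ha.inj i i' (f i) (hf i hi) (e ▸ hf i' hi')
      have h2 : (D.erase x).card ≤
          (Finset.univ.filter fun i => ∃ t ∈ D, b i = some t).card := by
        have hpre : ∀ t ∈ D.erase x, ∃ i, b i = some t := fun t ht =>
          hD t (Finset.mem_of_mem_erase ht) (Finset.ne_of_mem_erase ht)
        have : Nonempty Buyer := ⟨(hD y hyD hxy.symm).choose⟩
        choose! f hf using hpre
        refine Finset.card_le_card_of_injOn f (fun t ht => ?_) fun t ht t' ht' e => ?_
        · have := hf t ht
          simp only [Finset.coe_filter, Finset.mem_univ, true_and, Set.mem_ofPred_eq]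
          exact ⟨t, Finset.mem_of_mem_erase ht, this⟩
        · have e1 := hf t ht
          have e2 := hf t' ht'
          rw [e, e2] at e1
          exact (Option.some.inj e1).symm
      rw [Finset.card_erase_of_mem hyD] at h1
      rw [Finset.card_erase_of_mem hxD] at h2
      have h3 : (Finset.univ.filter fun i => ∃ t ∈ D, b i = some t) ⊆
          Finset.univ.filter (· ∈ C) := fun i hi => by
        simp only [Finset.mem_filter, Finset.mem_univ, true_and] at hi ⊢
        obtain ⟨t, ht, e⟩ := hi
        exact (hCb i t e).2 ht
      have h4 := Finset.eq_of_subset_of_card_le h3 (h1.trans h2)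
      intro i hi
      have : i ∈ Finset.univ.filter fun i => ∃ t ∈ D, b i = some t := by
        rw [h4]; simpa using hi
      simp only [Finset.mem_filter, Finset.mem_univ, true_and] at this
      obtain ⟨t, -, e⟩ := this
      exact ⟨t, e⟩
    have h5 : matchWeight w (C.piecewise b a) = matchWeight w a :=
      matchWeight_piecewise C fun i hi => by
        obtain ⟨s, e⟩ := hC i hi
        obtain ⟨t, e'⟩ := hbC i hi
        simp [e, e']
    refine hlt.not_ge ?_
    rw [← ea, ← h5]
    refine (hb.piecewise ha (D := (D : Set τ)) hCb hCa (fun s hs _ => hs)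
      fun s hs hsD => ?_).le_optWeight
    have : s ≠ x := fun e => hsD (e ▸ hxD)
    simp only [Finset.mem_insert] at hs ⊢
    tauto
  · rw [← ea, ← eb, ← matchWeight_piecewise_add C]
    refine add_le_add (IsMatching.le_optWeight ?_) (IsMatching.le_optWeight ?_)
    · refine ha.piecewise hb hCa hCb (fun s hs _ => ?_) fun s hs _ => ?_
      · simp only [Finset.mem_insert] at hs ⊢
        tauto
      · exact Finset.mem_insert_of_mem hs
    · refine hb.piecewise ha hCb hCa (fun s hs hsD => ?_) fun s hs hsD => ?_
      · have : s ≠ y := fun e => hyD (e ▸ hsD)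
        simp only [Finset.mem_insert] at hs
        tauto
      · have : s ≠ x := fun e => hsD (e ▸ hxD)
        simp only [Finset.mem_insert] at hs
        tauto

/-- A seller with more links is worth more. -/
theorem optWeight_insert_le_insert {F : Finset τ} {x y : τ} (hy : y ∉ F)
    (hxy : ∀ i, h i x → h i y) : optWeight h w (insert x F) ≤ optWeight h w (insert y F) := by
  by_cases hx : x ∈ F
  · rw [Finset.insert_eq_self.2 hx]
    exact optWeight_mono (Finset.subset_insert y F)
  refine optWeight_le_of_injOn (fun s => if s = x then y else s) ?_ ?_ ?_
  · intro s hs t ht e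
    simp only [Finset.coe_insert, Set.mem_insert_iff, Finset.mem_coe] at hs ht
    dsimp only at e
    split_ifs at e with h1 h2 h2
    · rw [h1, h2]
    · exact absurd (ht.resolve_left h2) (e ▸ hy)
    · exact absurd (hs.resolve_left h1) (e ▸ hy)
    · exact e
  · intro i s _ hs
    split_ifs with h1
    · exact hxy i (h1 ▸ hs)
    · exact hs
  · intro s hs
    split_ifs with h1
    · simp
    · exact Finset.mem_insert_of_mem ((Finset.mem_insert.1 hs).resolve_left h1)

end Matching

/-! ### Maximum competitive prices are marginal weights. -/

section MaxPrice

variable {Buyer τ : Type*} {h : Buyer → τ → Prop} [DecidableEq τ]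

/-- The network `h` with one more seller, linked only to the buyer `i`. -/
def addPrivateSeller (h : Buyer → τ → Prop) (i : Buyer) (i' : Buyer) : Option τ → Prop
  | none => i' = i
  | some s => h i' s

-- Buyer `i` moves to the private seller and vacates her former seller, whom `T'` may therefore
-- omit.
open Classical in
theorem IsMatching.update_addPrivateSeller {T T' : Finset τ} {a : Buyer → Option τ}
    (ha : IsMatching h T a) (i : Buyer) (hT : ∀ i' s, a i' = some s → i' ≠ i → s ∈ T') :
    IsMatching (addPrivateSeller h i) (insert none (T'.image some))
      (Function.update (fun i' => (a i').map some) i (some none)) := by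
  refine ⟨fun i' s e => ?_, fun i' s e => ?_, fun i' i'' s e e' => ?_⟩
  · by_cases hi : i' = i
    · subst hi
      simp at e
      simp [← e]
    · rw [Function.update_of_ne hi] at e
      obtain ⟨t, ht, rfl⟩ := Option.map_eq_some_iff.1 e
      simp [hT i' t ht hi]
  · by_cases hi : i' = i
    · subst hi
      simp at e
      simp [← e, addPrivateSeller]
    · rw [Function.update_of_ne hi] at e
      obtain ⟨t, ht, rfl⟩ := Option.map_eq_some_iff.1 e
      exact ha.link i' t ht
  · by_cases hi : i' = i <;> by_cases hi' : i'' = i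
    · rw [hi, hi']
    · rw [Function.update_of_ne hi'] at e'
      subst hi
      obtain ⟨t, -, rfl⟩ := Option.map_eq_some_iff.1 e'
      simp at e
    · rw [Function.update_of_ne hi] at e
      subst hi'
      obtain ⟨t, -, rfl⟩ := Option.map_eq_some_iff.1 e
      simp at e'
    · rw [Function.update_of_ne hi] at e
      rw [Function.update_of_ne hi'] at e'
      obtain ⟨t, ht, rfl⟩ := Option.map_eq_some_iff.1 e
      obtain ⟨t', ht', e'⟩ := Option.map_eq_some_iff.1 e'
      exact ha.inj i' i'' t ht (by rw [ht', Option.some.inj e'])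

variable [Fintype Buyer] {w : Buyer → ℝ}

theorem optWeight_image {ρ σ : Type*} [DecidableEq σ] {h : Buyer → ρ → Prop}
    {h' : Buyer → σ → Prop} {T : Finset ρ} (e : ρ → σ) (f : σ → ρ) (hf : ∀ s, f (e s) = s)
    (hl : ∀ i, ∀ s ∈ T, h i s ↔ h' i (e s)) : optWeight h' w (T.image e) = optWeight h w T := by
  refine le_antisymm (optWeight_le_of_injOn f ?_ ?_ ?_)
    (optWeight_le_of_injOn e (Function.LeftInverse.injective hf).injOn
      (fun i s hs => (hl i s hs).1) fun s hs => Finset.mem_image_of_mem e hs)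
  · intro s hs t ht est
    obtain ⟨s, -, rfl⟩ := Finset.mem_image.1 hs
    obtain ⟨t, -, rfl⟩ := Finset.mem_image.1 ht
    rw [hf, hf] at est
    rw [est]
  · intro i s hs hi
    obtain ⟨s, hs', rfl⟩ := Finset.mem_image.1 hs
    rw [hf]
    exact (hl i s hs').2 hi
  · intro s hs
    obtain ⟨s, hs, rfl⟩ := Finset.mem_image.1 hs
    rwa [hf]

theorem optWeight_addPrivateSeller (i : Buyer) (k : τ) (T : Finset τ) :
    optWeight (addPrivateSeller h i) w (T.image some) = optWeight h w T :=
  optWeight_image some (fun o => o.getD k) (fun _ => rfl) fun _ _ _ => Iff.rfl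

open Classical in
theorem matchWeight_update {σ : Type*} {a : Buyer → Option σ} {i : Buyer} {o : Option σ} :
    matchWeight w (Function.update a i o) =
      matchWeight w a - (if (a i).isSome then w i else 0) + if o.isSome then w i else 0 := by
  simp only [matchWeight]
  rw [← Finset.add_sum_erase _ _ (Finset.mem_univ i), ← Finset.add_sum_erase (Finset.univ)
    (fun i => if (a i).isSome then w i else 0) (Finset.mem_univ i),
    Finset.sum_congr rfl fun i' hi' => by rw [Function.update_of_ne (Finset.ne_of_mem_erase hi')]]
  simp
  ring

theorem matchWeight_map {ρ σ : Type*} {a : Buyer → Option ρ} (e : ρ → σ) :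
    matchWeight w (fun i => (a i).map e) = matchWeight w a := by
  simp [matchWeight]

/-- Removing a seller costs at most the value of her buyer. -/
theorem IsMatching.matchWeight_le {T : Finset τ} {a : Buyer → Option τ} (ha : IsMatching h T a)
    {i : Buyer} {s : τ} (hi : a i = some s) :
    matchWeight w a ≤ optWeight h w (T.erase s) + w i := by
  classical
  have : IsMatching h (T.erase s) (Function.update a i none) := by
    refine ⟨fun i' t e => ?_, fun i' t e => ?_, fun i' i'' t e e' => ?_⟩
    · have hne : i' ≠ i := by rintro rfl; simp at e
      rw [Function.update_of_ne hne] at e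
      refine Finset.mem_erase.2 ⟨?_, ha.mem i' t e⟩
      rintro rfl
      exact hne (ha.inj i' i t e hi)
    · have hne : i' ≠ i := by rintro rfl; simp at e
      rw [Function.update_of_ne hne] at e
      exact ha.link i' t e
    · have hne : i' ≠ i := by rintro rfl; simp at e
      have hne' : i'' ≠ i := by rintro rfl; simp at e'
      rw [Function.update_of_ne hne] at e
      rw [Function.update_of_ne hne'] at e'
      exact ha.inj i' i'' t e e'
  have := this.le_optWeight (w := w)
  rw [matchWeight_update] at this
  simp [hi] at this
  linarith

/-- In an optimal matching, a buyer's seller is worth no more than any other seller linked to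
her. -/
theorem optWeight_erase_le_erase {S : Finset τ} {a : Buyer → Option τ} (ha : IsMatching h S a)
    (hopt : matchWeight w a = optWeight h w S) {i : Buyer} {j k : τ} (hi : a i = some j)
    (hk : k ∈ S) (hik : h i k) : optWeight h w (S.erase k) ≤ optWeight h w (S.erase j) := by
  classical
  obtain rfl | hjk := eq_or_ne j k
  · exact le_rfl
  have hj := ha.mem i j hi
  set f := optWeight (addPrivateSeller h i) w
  set F : Finset (Option τ) := ((S.erase j).erase k).image some
  have hnF : none ∉ F := by simp [F]
  have hjF : some j ∉ F := by simp [F]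
  have hkF : some k ∉ F := by simp [F]
  have e1 : f (insert (some k) F) = optWeight h w (S.erase j) := by
    rw [← optWeight_addPrivateSeller i k, ← Finset.image_insert,
      Finset.insert_erase (Finset.mem_erase.2 ⟨hjk.symm, hk⟩)]
  have e2 : f (insert (some j) F) = optWeight h w (S.erase k) := by
    rw [← optWeight_addPrivateSeller i k, ← Finset.image_insert, Finset.erase_right_comm,
      Finset.insert_erase (Finset.mem_erase.2 ⟨hjk, hj⟩)]
  have e3 : f (insert (some j) (insert (some k) F)) = optWeight h w S := by
    rw [← optWeight_addPrivateSeller i k, ← Finset.image_insert, ← Finset.image_insert,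
      Finset.insert_erase (Finset.mem_erase.2 ⟨hjk.symm, hk⟩), Finset.insert_erase hj]
  -- With a private seller for `i`, the good `j` is no longer needed.
  have e4 : optWeight h w S ≤ f (insert none (insert (some k) F)) := by
    have := (ha.update_addPrivateSeller (T' := S.erase j) i fun i' s e hne =>
      Finset.mem_erase.2 ⟨fun es => hne (ha.inj i' i j (es ▸ e) hi), ha.mem i' s e⟩).le_optWeight
        (w := w)
    rw [matchWeight_update, matchWeight_map] at this
    simp only [hi, hopt, Option.map_some, Option.isSome_some, if_true, sub_add_cancel] at this
    rwa [← Finset.image_insert, Finset.insert_erase (Finset.mem_erase.2 ⟨hjk.symm, hk⟩)]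
  -- Otherwise `j` and `k` have different marginals over `F`, which add up. But `none` replaces `j`
  -- without loss, while `none` is worth at most `k` and is a substitute for it; the bounds clash.
  rw [← e1, ← e2]
  by_contra! hlt
  have h1 : f (insert none F) ≤ f (insert (some k) F) :=
    optWeight_insert_le_insert hkF fun i' hi' => by
      cases (show i' = i from hi')
      exact hik
  have h2 := optWeight_insert_add_insert_le (h := addPrivateSeller h i) (w := w) hjF hkF
    (by simpa using hjk) hlt
  have h3 := optWeight_insert_insert_add_le (h := addPrivateSeller h i) (w := w) hnF hkF
    (by simp)
  linarith

/-- A buyer unmatched in an optimal matching is worth no more than any seller linked to her. -/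
theorem optWeight_erase_add_le {S : Finset τ} {a : Buyer → Option τ} (ha : IsMatching h S a)
    (hopt : matchWeight w a = optWeight h w S) {i : Buyer} {k : τ} (hi : a i = none)
    (hk : k ∈ S) (hik : h i k) : optWeight h w (S.erase k) + w i ≤ optWeight h w S := by
  classical
  set f := optWeight (addPrivateSeller h i) w
  set F : Finset (Option τ) := (S.erase k).image some
  have hnF : none ∉ F := by simp [F]
  have hkF : some k ∉ F := by simp [F]
  have e1 : f F = optWeight h w (S.erase k) := optWeight_addPrivateSeller i k _
  have e2 : f (insert (some k) F) = optWeight h w S := by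
    rw [← optWeight_addPrivateSeller i k, ← Finset.image_insert, Finset.insert_erase hk]
  have e3 : optWeight h w S + w i ≤ f (insert none (insert (some k) F)) := by
    have := (ha.update_addPrivateSeller (T' := S) i fun i' s e _ => ha.mem i' s e).le_optWeight
      (w := w)
    rw [matchWeight_update, matchWeight_map] at this
    simp only [hi, hopt, Option.map_none, Option.isSome_none, Option.isSome_some, if_true] at this
    rw [← Finset.image_insert, Finset.insert_erase hk]
    simpa using this
  have h1 : f (insert none F) ≤ f (insert (some k) F) :=
    optWeight_insert_le_insert hkF fun i' hi' => by
      cases (show i' = i from hi')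
      exact hik
  have h3 := optWeight_insert_insert_add_le (h := addPrivateSeller h i) (w := w) hnF hkF
    (by simp)
  linarith

open Classical in
theorem sum_elim_eq [Fintype τ] {T : Finset τ} {a : Buyer → Option τ} (ha : IsMatching h T a)
    (p : τ → ℝ) : ∑ i, (a i).elim 0 p = ∑ j, if ∃ i, a i = some j then p j else 0 := by
  have h1 : ∀ i, (a i).elim 0 p = ∑ j, if a i = some j then p j else 0 := by
    intro i
    cases a i <;> simp
  simp only [h1]
  rw [Finset.sum_comm]
  refine Finset.sum_congr rfl fun j _ => ?_
  split_ifs with hj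
  · obtain ⟨i, hi⟩ := hj
    rw [Finset.sum_eq_single i]
    · simp [hi]
    · intro i' _ hne
      rw [if_neg fun e => hne (ha.inj i' i j e hi)]
    · simp
  · push Not at hj
    simp [hj]

/-- The marginal weight of a seller. -/
noncomputable def marginalWeight [Fintype τ] (h : Buyer → τ → Prop) (w : Buyer → ℝ) (j : τ) : ℝ :=
  optWeight h w Finset.univ - optWeight h w (Finset.univ.erase j)

variable [Fintype τ]

/-- Weak duality: utilities plus all prices equal the weight of the equilibrium allocation, while
utilities plus the prices other than that of `j` bound any matching that avoids `j`. -/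
theorem IsCompetitivePrice.le_marginalWeight {p : τ → ℝ}
    (hp : IsCompetitivePrice (homogeneousValue w) h p) (j : τ) : p j ≤ marginalWeight h w j := by
  classical
  obtain ⟨a, ha⟩ := hp
  have hm : IsMatching h Finset.univ a :=
    ⟨fun _ _ _ => Finset.mem_univ _, ha.respects_links, ha.sold_at_most_once⟩
  obtain ⟨b, hb, eb⟩ := exists_isMatching_eq_optWeight h w (Finset.univ.erase j)
  set u : Buyer → ℝ := fun i => buyerUtility (homogeneousValue w) p i (a i)
  have h1 : matchWeight w a = ∑ i, u i + ∑ j, p j := by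
    have : ∑ i, (a i).elim 0 p = ∑ j, p j := by
      rw [sum_elim_eq hm]
      refine Finset.sum_congr rfl fun j _ => ?_
      split_ifs with hj
      · rfl
      · push Not at hj
        exact (ha.unsold_price_zero j hj).symm
    rw [← this, ← Finset.sum_add_distrib]
    refine Finset.sum_congr rfl fun i _ => ?_
    cases e : a i <;> simp [u, e, buyerUtility, homogeneousValue]
  have h2 : matchWeight w b ≤ ∑ i, u i + ∑ i, (b i).elim 0 p := by
    rw [← Finset.sum_add_distrib]
    refine Finset.sum_le_sum fun i _ => ?_
    cases e : b i with
    | none => simpa using ha.utility_nonneg i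
    | some k =>
      have := ha.most_preferred i k (hb.link i k e)
      simp only [Option.isSome_some, if_true, Option.elim_some, u]
      change w i - p k ≤ _ at this
      linarith
  have h3 : ∑ i, (b i).elim 0 p ≤ ∑ k ∈ Finset.univ.erase j, p k := by
    rw [sum_elim_eq hb, ← Finset.add_sum_erase _ _ (Finset.mem_univ j), if_neg, zero_add]
    · refine Finset.sum_le_sum fun k _ => ?_
      split_ifs
      exacts [le_rfl, ha.price_nonneg k]
    · rintro ⟨i, hi⟩
      exact Finset.notMem_erase j _ (hb.mem i j hi)
  have h4 := Finset.add_sum_erase Finset.univ p (Finset.mem_univ j)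
  have h5 := hm.le_optWeight (w := w)
  simp only [marginalWeight]
  linarith

/-- Any optimal matching supports these prices; the demand conditions are the comparisons obtained
with a private seller. -/
theorem isCompetitivePrice_marginalWeight :
    IsCompetitivePrice (homogeneousValue w) h (marginalWeight h w) := by
  obtain ⟨a, ha, ea⟩ := exists_isMatching_eq_optWeight h w Finset.univ
  refine ⟨a, ?_, ha.link, ha.inj, ?_, ?_, ?_⟩
  · exact fun j => sub_nonneg.2 (optWeight_mono (Finset.erase_subset _ _))
  · intro i k hik
    cases e : a i with
    | none =>
      have := optWeight_erase_add_le ha ea e (Finset.mem_univ k) hik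
      simp only [homogeneousValue, buyerUtility, marginalWeight]
      linarith
    | some j =>
      have := optWeight_erase_le_erase ha ea e (Finset.mem_univ k) hik
      simp only [homogeneousValue, buyerUtility, marginalWeight]
      linarith
  · intro i
    cases e : a i with
    | none => exact le_rfl
    | some j =>
      have := ha.matchWeight_le (w := w) e
      simp only [homogeneousValue, buyerUtility, marginalWeight]
      linarith
  · intro j hj
    have : IsMatching h (Finset.univ.erase j) a :=
      ha.mono fun i s e => Finset.mem_erase.2 ⟨fun es => hj i (es ▸ e), Finset.mem_univ s⟩
    have h1 := this.le_optWeight (w := w)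
    have h2 := optWeight_mono (h := h) (w := w) (Finset.erase_subset j Finset.univ)
    simp only [marginalWeight]
    linarith

theorem maxPrice_eq_marginalWeight :
    maxPrice (homogeneousValue w) h = marginalWeight h w := by
  funext j
  refine IsGreatest.csSup_eq ⟨⟨_, isCompetitivePrice_marginalWeight, rfl⟩, ?_⟩
  rintro _ ⟨p, hp, rfl⟩
  exact hp.le_marginalWeight j

theorem isGreatest_maxPrice :
    IsGreatest {p | IsCompetitivePrice (homogeneousValue w) h p}
      (maxPrice (homogeneousValue w) h) := by
  rw [maxPrice_eq_marginalWeight]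
  exact ⟨isCompetitivePrice_marginalWeight, fun p hp j => hp.le_marginalWeight j⟩

end MaxPrice

/-! ### Comparisons of marginal weights when fully linked sellers are added. -/

section Substitutes

variable {Buyer τ : Type*} [Fintype Buyer] [DecidableEq τ] {h : Buyer → τ → Prop} {w : Buyer → ℝ}
  {F : Finset τ} {x y u : τ}

theorem optWeight_insert_eq_or_add_le (hx : x ∉ F) (hu : u ∉ F) (hxu : x ≠ u)
    (hl : ∀ i, h i x → h i u) :
    optWeight h w (insert u F) = optWeight h w (insert x F) ∨
      optWeight h w (insert u F) + optWeight h w (insert x F) ≤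
        optWeight h w (insert u (insert x F)) + optWeight h w F := by
  rcases (optWeight_insert_le_insert (w := w) hu hl).eq_or_lt with e | e
  · exact .inl e.symm
  · exact .inr (optWeight_insert_add_insert_le hu hx hxu.symm e)

/-- The marginal weight of a better linked seller `u`, with and without `x`. -/
theorem optWeight_insert_sub_eq_max (hx : x ∉ F) (hu : u ∉ F) (hxu : x ≠ u)
    (hl : ∀ i, h i x → h i u) :
    optWeight h w (insert u F) - optWeight h w F =
      max (optWeight h w (insert x F) - optWeight h w F)
        (optWeight h w (insert u (insert x F)) - optWeight h w (insert x F)) := by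
  have h1 := optWeight_insert_le_insert (w := w) hu hl
  have h2 := optWeight_insert_insert_add_le (h := h) (w := w) hu hx hxu.symm
  rcases optWeight_insert_eq_or_add_le (w := w) hx hu hxu hl with e | e
  · rw [max_eq_left] <;> linarith
  · rw [max_eq_right] <;> linarith

/-- Compare `u'` with `x` over `insert u F`. If they are worth the same, replace `u'` by `x`; if
their marginals add up, adding `x` does not lower the marginal of `u'`, and substitutability
finishes. -/
theorem optWeight_sub_le_of_forall_link {u' : τ} (hx : x ∉ F) (hu : u ∉ F) (hu' : u' ∉ F)
    (hxu : x ≠ u) (hxu' : x ≠ u') (huu' : u ≠ u') (hl : ∀ i, h i u) (hl' : ∀ i, h i u') :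
    optWeight h w (insert u' (insert u F)) - optWeight h w (insert u F) ≤
      optWeight h w (insert u (insert x F)) - optWeight h w (insert x F) := by
  have h1 := optWeight_insert_le_insert (h := h) (w := w) (F := F) (x := x) hu fun i _ => hl i
  have h2 := optWeight_insert_insert_add_le (h := h) (w := w) (F := insert x F) (x := u) (y := u')
    (by simp [hu, hxu.symm]) (by simp [hu', hxu'.symm]) huu'
  have h3 := optWeight_insert_le_insert (h := h) (w := w) (F := insert x F) (x := u') (y := u)
    (by simp [hu, hxu.symm]) fun i _ => hl i
  have h4 := optWeight_insert_eq_or_add_le (h := h) (w := w) (F := insert u F) (x := x) (u := u')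
    (by simp [hx, hxu]) (by simp [hu', huu'.symm]) hxu' fun i _ => hl' i
  rw [Finset.insert_comm x u F, Finset.insert_comm u' u (insert x F)] at h4
  rcases h4 with e | e <;> linarith

/-- If `u` and `x` are worth the same over `F`, replacing `y` by `u` suffices. Otherwise `u` does
not depress the marginal of `x`, which is at least that of `y`. -/
theorem optWeight_sub_le_sub_of_le (hx : x ∉ F) (hy : y ∉ F) (hu : u ∉ F) (hxy : x ≠ y)
    (hxu : x ≠ u) (hl : ∀ i, h i u)
    (hle : optWeight h w (insert y F) ≤ optWeight h w (insert x F)) :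
    optWeight h w (insert y (insert x F)) - optWeight h w (insert x F) ≤
      optWeight h w (insert x (insert u F)) - optWeight h w (insert u F) := by
  have h1 := optWeight_insert_le_insert (h := h) (w := w) (F := insert x F) (x := y) (y := u)
    (by simp [hu, hxu.symm]) fun i _ => hl i
  have h2 := optWeight_insert_insert_add_le (h := h) (w := w) hy hx hxy.symm
  rw [Finset.insert_comm x u]
  rcases optWeight_insert_eq_or_add_le (h := h) (w := w) hx hu hxu fun i _ => hl i with e | e <;>
    linarith

/-- If `x` were worth more than `y` over `insert u F`, its marginal there would survive the addition
of `y`, and then be bounded by its marginal over `insert y F`. -/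
theorem optWeight_le_of_sub_le_sub (hx : x ∉ F) (hy : y ∉ F) (hu : u ∉ F) (hxy : x ≠ y)
    (hxu : x ≠ u) (hyu : y ≠ u)
    (hle : optWeight h w (insert x (insert y F)) - optWeight h w (insert y F) ≤
      optWeight h w (insert y (insert u F)) - optWeight h w (insert u F)) :
    optWeight h w (insert x (insert u F)) ≤ optWeight h w (insert y (insert u F)) := by
  by_contra! hlt
  have h1 := optWeight_insert_add_insert_le (h := h) (w := w) (F := insert u F) (x := x) (y := y)
    (by simp [hx, hxu]) (by simp [hy, hyu]) hxy hlt
  have h2 := optWeight_insert_insert_add_le (h := h) (w := w) (F := insert y F) (x := x) (y := u)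
    (by simp [hx, hxy]) (by simp [hu, hyu.symm]) hxu
  rw [Finset.insert_comm u y F] at h2
  linarith

end Substitutes

/-! ### Prices on and off the platform as marginals in the network of copies. -/

section Prices

variable {Buyer Seller : Type*} [DecidableEq Seller]

/-- The network in which each seller has a copy off the platform, with her own links, and a copy
on the platform, linked to all buyers. -/
def copiesNetwork (g : Buyer → Seller → Prop) : Buyer → Seller × Bool → Prop :=
  fun i s => s.2 = true ∨ g i s.1

/-- The copies of the sellers in `T` that are present when `P` is on the platform. -/
def copies (P T : Finset Seller) : Finset (Seller × Bool) :=
  T.image fun j => (j, decide (j ∈ P))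

variable {P T : Finset Seller} {j k : Seller}

theorem notMem_copies {c : Bool} (hj : j ∉ T) : (j, c) ∉ copies P T := by
  simp only [copies, Finset.mem_image, Prod.mk.injEq, not_exists, not_and]
  rintro k hk rfl
  exact absurd hk hj

theorem copies_eq_insert (hj : j ∈ T) :
    copies P T = insert (j, decide (j ∈ P)) (copies P (T.erase j)) := by
  rw [copies, copies, ← Finset.image_insert (fun j => (j, decide (j ∈ P))),
    Finset.insert_erase hj]

theorem copies_insert (hj : j ∉ T) : copies (insert j P) T = copies P T := by
  refine Finset.image_congr fun k hk => ?_
  have : k ≠ j := fun e => hj (e ▸ hk)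
  simp [this]

variable [Fintype Buyer] [Fintype Seller] {g : Buyer → Seller → Prop} {w : Buyer → ℝ}

local notation "V" => optWeight (copiesNetwork g) w
local notation "pOff" => offPrice (homogeneousValue w) g
local notation "pOn" => onPrice (homogeneousValue w) g

theorem platformPrice_eq :
    platformPrice (homogeneousValue w) g P j =
      V (copies P Finset.univ) - V (copies P (Finset.univ.erase j)) := by
  have : ∀ T, V (copies P T) = optWeight (platformGraph g P) w T := fun T =>
    optWeight_image _ Prod.fst (fun _ => rfl) fun i s _ => by
      simp [copiesNetwork, platformGraph]
  rw [platformPrice, maxPrice_eq_marginalWeight, marginalWeight, this, this]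

theorem offPrice_eq (hj : j ∉ P) :
    pOff P j = V (insert (j, false) (copies P (Finset.univ.erase j))) -
      V (copies P (Finset.univ.erase j)) := by
  rw [offPrice, Finset.erase_eq_of_notMem hj, platformPrice_eq,
    copies_eq_insert (Finset.mem_univ j), decide_eq_false hj]

theorem onPrice_eq :
    pOn P j = V (insert (j, true) (copies P (Finset.univ.erase j))) -
      V (copies P (Finset.univ.erase j)) := by
  rw [onPrice, platformPrice_eq, copies_eq_insert (Finset.mem_univ j),
    decide_eq_true (Finset.mem_insert_self j P), copies_insert (Finset.notMem_erase j _)]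

theorem copies_erase_eq (hk : k ∉ P) (hjk : j ≠ k) :
    copies P (Finset.univ.erase j) =
      insert (k, false) (copies P ((Finset.univ.erase j).erase k)) := by
  rw [copies_eq_insert (Finset.mem_erase.2 ⟨hjk.symm, Finset.mem_univ k⟩), decide_eq_false hk]

theorem copies_insert_erase_eq (hjk : j ≠ k) :
    copies (insert k P) (Finset.univ.erase j) =
      insert (k, true) (copies P ((Finset.univ.erase j).erase k)) := by
  rw [copies_eq_insert (Finset.mem_erase.2 ⟨hjk.symm, Finset.mem_univ k⟩),
    decide_eq_true (Finset.mem_insert_self k P), copies_insert (Finset.notMem_erase k _)]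

theorem platformPrice_nonneg : 0 ≤ platformPrice (homogeneousValue w) g P j := by
  rw [platformPrice_eq, sub_nonneg]
  exact optWeight_mono (Finset.image_subset_image (Finset.erase_subset _ _))

/-- All sellers on the platform have the same price. -/
theorem platformPrice_eq_of_mem (hj : j ∈ P) (hk : k ∈ P) :
    platformPrice (homogeneousValue w) g P j = platformPrice (homogeneousValue w) g P k := by
  have key : ∀ {j k}, j ∈ P → k ∈ P → j ≠ k →
      V (copies P (Finset.univ.erase j)) ≤ V (copies P (Finset.univ.erase k)) := by
    intro j k hj hk hjk
    rw [copies_eq_insert (Finset.mem_erase.2 ⟨hjk.symm, Finset.mem_univ k⟩),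
      copies_eq_insert (j := j) (Finset.mem_erase.2 ⟨hjk, Finset.mem_univ j⟩),
      decide_eq_true hj, decide_eq_true hk, Finset.erase_right_comm]
    exact optWeight_insert_le_insert (notMem_copies (Finset.notMem_erase j _)) fun i _ => .inl rfl
  obtain rfl | hjk := eq_or_ne j k
  · rfl
  · rw [platformPrice_eq, platformPrice_eq, (key hj hk hjk).antisymm (key hk hj hjk.symm)]

/-- The price on the platform is the larger of the price off the platform and a quantity common to
all sellers. -/
theorem exists_onPrice_eq_max :
    ∃ c, ∀ j ∉ P, pOn P j = max (pOff P j) c := by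
  by_cases hP : ∃ k, k ∉ P
  · obtain ⟨k, hk⟩ := hP
    -- The common quantity is the marginal of one extra, fully linked seller in the whole market;
    -- which outsider labels it is irrelevant.
    refine ⟨V (insert (k, true) (copies P Finset.univ)) - V (copies P Finset.univ),
      fun j hj => ?_⟩
    have key : ∀ {j k}, j ∉ P → V (insert (k, true) (copies P Finset.univ)) ≤
        V (insert (j, true) (copies P Finset.univ)) := fun {j k} hj =>
      optWeight_insert_le_insert (by simp [copies, hj]) fun i _ => .inl rfl
    rw [(key hj).antisymm (key hk), onPrice_eq, offPrice_eq hj, copies_eq_insert (Finset.mem_univ j),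
      decide_eq_false hj]
    exact optWeight_insert_sub_eq_max (notMem_copies (Finset.notMem_erase j _))
      (notMem_copies (Finset.notMem_erase j _)) (by simp) fun i _ => .inl rfl
  · push Not at hP
    exact ⟨0, fun j hj => absurd (hP j) hj⟩

/-- Prices on the platform fall when a seller joins. -/
theorem onPrice_insert_le (hj : j ∉ P) (hjk : j ≠ k) : pOn (insert k P) j ≤ pOn P k := by
  rw [onPrice_eq, onPrice_eq, copies_insert_erase_eq hjk, copies_erase_eq hj hjk.symm,
    Finset.erase_right_comm (a := k)]
  have h1 : ∀ c, (j, c) ∉ copies P ((Finset.univ.erase j).erase k) := fun c =>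
    notMem_copies (by simp)
  have h2 : ∀ c, (k, c) ∉ copies P ((Finset.univ.erase j).erase k) := fun c =>
    notMem_copies (by simp)
  exact optWeight_sub_le_of_forall_link (h1 _) (h2 _) (h1 _) (by simp [hjk]) (by simp)
    (by simp [hjk.symm]) (fun i => .inl rfl) fun i => .inl rfl

/-- The lowest price off the platform does not fall when its seller joins. -/
theorem offPrice_le_offPrice_insert (hj : j ∉ P) (hk : k ∉ P) (hjk : j ≠ k)
    (hle : pOff P k ≤ pOff P j) : pOff P k ≤ pOff (insert k P) j := by
  have h1 : ∀ c, (j, c) ∉ copies P ((Finset.univ.erase j).erase k) := fun c =>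
    notMem_copies (by simp)
  have h2 : ∀ c, (k, c) ∉ copies P ((Finset.univ.erase j).erase k) := fun c =>
    notMem_copies (by simp)
  rw [offPrice_eq hk, copies_erase_eq hj hjk.symm, Finset.erase_right_comm (a := k)] at hle ⊢
  rw [offPrice_eq hj, copies_erase_eq hk hjk, Finset.insert_comm (k, false)] at hle
  rw [offPrice_eq (by simp [hj, hjk]), copies_insert_erase_eq hjk]
  refine optWeight_sub_le_sub_of_le (h1 _) (h2 _) (h2 _) (by simp [hjk]) (by simp [hjk])
    (fun i => .inl rfl) ?_
  linarith

/-- Keeps the off prices of earlier members below that of a new member. The two on-platform copies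
are interchangeable, so both prices become marginals over the same set. -/
theorem offPrice_insert_le_offPrice_insert (hj : j ∉ P) (hk : k ∉ P) (hjk : j ≠ k)
    (hle : pOff P j ≤ pOff (insert j P) k) : pOff (insert k P) j ≤ pOff (insert j P) k := by
  have h1 : ∀ c, (j, c) ∉ copies P ((Finset.univ.erase j).erase k) := fun c =>
    notMem_copies (by simp)
  have h2 : ∀ c, (k, c) ∉ copies P ((Finset.univ.erase j).erase k) := fun c =>
    notMem_copies (by simp)
  have key : ∀ T, (j, true) ∉ T → (k, true) ∉ T → V (insert (j, true) T) = V (insert (k, true) T) :=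
    fun T hj hk => le_antisymm (optWeight_insert_le_insert hk fun i _ => .inl rfl)
      (optWeight_insert_le_insert hj fun i _ => .inl rfl)
  rw [offPrice_eq hj, copies_erase_eq hk hjk, offPrice_eq (by simp [hk, hjk.symm]),
    copies_insert_erase_eq hjk.symm, Finset.erase_right_comm (a := k)] at hle
  rw [offPrice_eq (by simp [hj, hjk]), copies_insert_erase_eq hjk,
    offPrice_eq (j := k) (by simp [hk, hjk.symm]), copies_insert_erase_eq hjk.symm,
    Finset.erase_right_comm (a := k), ← key _ (h1 _) (h2 _), Finset.insert_comm (j, false),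
    ← key _ (by simp [h1]) (by simp [h2, hjk.symm]), Finset.insert_comm (j, true)]
  exact sub_le_sub_right (optWeight_le_of_sub_le_sub (h1 _) (h2 _) (h1 _) (by simp [hjk]) (by simp)
    (by simp [hjk.symm]) hle) _

end Prices

/-! ### Candidates, the sweep invariant and the comparison with a fixed fee. -/

section Sweep

variable {Buyer Seller : Type*} [DecidableEq Seller] {g : Buyer → Seller → Prop}
  {w : Buyer → ℝ} {α β : ℝ} {P : Finset Seller} {j k : Seller}

theorem exists_lowest_offPrice [Fintype Seller] (w : Buyer → ℝ) (g : Buyer → Seller → Prop)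
    (hP : P ≠ Finset.univ) :
    ∃ k ∉ P, ∀ j ∉ P,
      offPrice (homogeneousValue w) g P k ≤ offPrice (homogeneousValue w) g P j := by
  have : (Finset.univ \ P).Nonempty := by
    rw [Finset.sdiff_nonempty]
    exact fun h => hP (Finset.univ_subset_iff.1 h)
  obtain ⟨k, hk, hmin⟩ := Finset.exists_min_image _ (offPrice (homogeneousValue w) g P) this
  simp only [Finset.mem_sdiff, Finset.mem_univ, true_and] at hk hmin
  exact ⟨k, hk, hmin⟩

/-- What holds whenever a sweep reaches the fee `α` with `P` on the platform: `π` is the price off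
the platform of the last seller to join, `q` her price on the platform, and `α₀` the fee then. -/
structure SweepInvariant (w : Buyer → ℝ) (g : Buyer → Seller → Prop) (α : ℝ) (P : Finset Seller)
    (α₀ π q : ℝ) : Prop where
  mem_Icc : α ∈ Set.Icc (0 : ℝ) 1
  fee_le : α ≤ α₀
  price_nonneg : 0 ≤ q
  indifferent : (1 - α₀) * q = π
  offPrice_le : ∀ j ∈ P, offPrice (homogeneousValue w) g P j ≤ π
  platformPrice_eq : ∀ j ∈ P, platformPrice (homogeneousValue w) g P j = q
  le_offPrice : ∀ j ∉ P, π ≤ offPrice (homogeneousValue w) g P j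
  onPrice_le : ∀ j ∉ P, onPrice (homogeneousValue w) g P j ≤ q
  gain_nonpos : ∀ j ∉ P, gain (homogeneousValue w) g α P j ≤ 0
  visits : ∀ β ∈ Set.Icc 0 α, AlgVisits (homogeneousValue w) g β P

/-- A member's off price is at most `π = (1 - α₀) * q ≤ (1 - α) * q`. -/
theorem SweepInvariant.isPurePlatformEquilibrium {α₀ π q : ℝ}
    (hI : SweepInvariant w g α P α₀ π q) :
    IsPurePlatformEquilibrium (homogeneousValue w) g α P := by
  refine ⟨fun j hj => ?_, fun j hj => ?_⟩
  · have h1 := hI.offPrice_le j hj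
    have h2 := mul_le_mul_of_nonneg_right hI.fee_le hI.price_nonneg
    have h3 := hI.indifferent
    rw [hI.platformPrice_eq j hj]
    simp only [offPrice] at h1
    linarith
  · have := hI.gain_nonpos j hj
    simp only [gain, onPrice, offPrice, Finset.erase_eq_of_notMem hj] at this
    linarith

variable [Fintype Buyer] [Fintype Seller]

local notation "pPrice" => platformPrice (homogeneousValue w) g
local notation "pOff" => offPrice (homogeneousValue w) g
local notation "pOn" => onPrice (homogeneousValue w) g
local notation "pGain" => gain (homogeneousValue w) g

theorem onPrice_nonneg : 0 ≤ pOn P j :=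
  platformPrice_nonneg

theorem offPrice_le_onPrice (hj : j ∉ P) : pOff P j ≤ pOn P j := by
  obtain ⟨c, hc⟩ := exists_onPrice_eq_max (P := P) (w := w) (g := g)
  rw [hc j hj]
  exact le_max_left _ _

theorem gain_anti (hαβ : α ≤ β) : pGain β P j ≤ pGain α P j := by
  have := mul_le_mul_of_nonneg_right hαβ (onPrice_nonneg (P := P) (j := j) (w := w) (g := g))
  simp only [gain]
  linarith

/-- The gain falls with the price off the platform. -/
theorem gain_le_gain_of_offPrice_le (hα : α ∈ Set.Icc (0 : ℝ) 1) (hj : j ∉ P) (hk : k ∉ P)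
    (hle : pOff P k ≤ pOff P j) : pGain α P j ≤ pGain α P k := by
  obtain ⟨c, hc⟩ := exists_onPrice_eq_max (P := P) (w := w) (g := g)
  -- As `max (off price) c`, the on price is monotone and 1-Lipschitz in the off price.
  have h1 : pOn P k ≤ pOn P j := by
    rw [hc j hj, hc k hk]
    exact max_le_max_right c hle
  have h2 : pOn P j - pOn P k ≤ pOff P j - pOff P k := by
    rw [hc j hj, hc k hk, sub_le_iff_le_add]
    refine max_le ?_ ?_
    · linarith [le_max_left (pOff P k) c]
    · linarith [le_max_right (pOff P k) c]
  have h3 := mul_nonneg hα.1 (sub_nonneg.2 h1)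
  simp only [gain]
  linarith

/-- The candidates are the sellers with the lowest price off the platform, whatever the fee. -/
theorem isCandidate_iff (hα : α ∈ Set.Icc (0 : ℝ) 1) :
    IsCandidate (homogeneousValue w) g α P k ↔ k ∉ P ∧ ∀ j ∉ P, pOff P k ≤ pOff P j := by
  refine ⟨fun ⟨hk, hmax, hmin⟩ => ⟨hk, fun j hj => ?_⟩, fun ⟨hk, hmin⟩ => ⟨hk, fun j hj =>
    gain_le_gain_of_offPrice_le hα hj hk (hmin j hj), fun j hj _ => hmin j hj⟩⟩
  by_contra! hlt
  exact hlt.not_ge (hmin j hj ((hmax j hj).antisymm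
    (gain_le_gain_of_offPrice_le hα hk hj hlt.le)))

theorem offPrice_nonneg : 0 ≤ pOff P j :=
  platformPrice_nonneg

/-- There is no last joiner yet; at fee `1` indifference with `π = 0` holds for any `q`, and the sum
is merely a bound for all on prices. -/
theorem sweepInvariant_start (w : Buyer → ℝ) (g : Buyer → Seller → Prop) :
    SweepInvariant w g 1 ∅ 1 0 (∑ j, onPrice (homogeneousValue w) g ∅ j) where
  mem_Icc := by simp
  fee_le := le_rfl
  price_nonneg := Finset.sum_nonneg fun _ _ => onPrice_nonneg
  indifferent := by simp
  offPrice_le := by simp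
  platformPrice_eq := by simp
  le_offPrice _ _ := offPrice_nonneg
  onPrice_le j _ := Finset.single_le_sum
    (f := onPrice (homogeneousValue w) g ∅) (fun _ _ => onPrice_nonneg) (Finset.mem_univ j)
  gain_nonpos j _ := by
    simp only [gain, sub_self, zero_mul, zero_sub, neg_nonpos]
    exact offPrice_nonneg
  visits _ _ := .refl

theorem gain_nonpos_of_forall_neg (hαβ : α ≤ β) (h : pGain β P j ≤ 0)
    (hneg : ∀ γ, α < γ → γ ≤ β → pGain γ P j < 0) : pGain α P j ≤ 0 := by
  by_contra! hpos
  have h0 := offPrice_nonneg (P := P) (j := j) (w := w) (g := g)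
  have h1 := onPrice_nonneg (P := P) (j := j) (w := w) (g := g)
  simp only [gain] at h hpos hneg
  have hon : 0 < pOn P j := by
    rcases h1.eq_or_lt with e | e
    · rw [← e] at hpos
      linarith
    · exact e
  have hroot : pOff P j / pOn P j * pOn P j = pOff P j := div_mul_cancel₀ _ hon.ne'
  -- The gain is affine in the fee; a sign change would put its zero strictly above `α` and at most
  -- `β`.
  have := hneg (1 - pOff P j / pOn P j) (by nlinarith) (by nlinarith)
  nlinarith

theorem SweepInvariant.lower {α₀ π q : ℝ} (hI : SweepInvariant w g α P α₀ π q) {α' : ℝ}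
    (h0 : 0 ≤ α') (hle : α' ≤ α) (hneg : ∀ β, α' < β → β ≤ α → ∀ j ∉ P, pGain β P j < 0) :
    SweepInvariant w g α' P α₀ π q :=
  { hI with
    mem_Icc := ⟨h0, hle.trans hI.mem_Icc.2⟩
    fee_le := hle.trans hI.fee_le
    gain_nonpos := fun j hj => gain_nonpos_of_forall_neg hle (hI.gain_nonpos j hj)
      fun γ h1 h2 => hneg γ h1 h2 j hj
    visits := fun β hβ => hI.visits β ⟨hβ.1, hβ.2.trans hle⟩ }

/-- The new member has gain exactly zero, so she is indifferent at the current fee. Afterwards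
outsiders have lower on prices and higher off prices than hers, hence no positive gain. -/
theorem SweepInvariant.add {α₀ π q : ℝ} (hI : SweepInvariant w g α P α₀ π q)
    (hk : IsCandidate (homogeneousValue w) g α P k) (hgain : 0 ≤ pGain α P k) :
    SweepInvariant w g α (insert k P) α (pOff P k) (pOn P k) := by
  obtain ⟨hkP, hmin⟩ := (isCandidate_iff hI.mem_Icc).1 hk
  have hind : (1 - α) * pOn P k = pOff P k := by
    have := hI.gain_nonpos k hkP
    simp only [gain] at this hgain
    linarith
  have hle_off : ∀ j ∉ insert k P, pOff P k ≤ pOff (insert k P) j := fun j hj => by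
    obtain ⟨hjk, hj⟩ := not_or.1 (mt Finset.mem_insert.2 hj)
    exact offPrice_le_offPrice_insert hj hkP hjk (hmin j hj)
  have hon_le : ∀ j ∉ insert k P, pOn (insert k P) j ≤ pOn P k := fun j hj => by
    obtain ⟨hjk, hj⟩ := not_or.1 (mt Finset.mem_insert.2 hj)
    exact onPrice_insert_le hj hjk
  refine ⟨hI.mem_Icc, le_rfl, onPrice_nonneg, hind, fun j hj => ?_, fun j hj => ?_, hle_off, hon_le,
    fun j hj => ?_, fun β hβ => ?_⟩
  · rcases Finset.mem_insert.1 hj with rfl | hj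
    · simp [offPrice]
    · have hjk : j ≠ k := fun e => hkP (e ▸ hj)
      -- The old `π` separates the off price of the member `j` from that of the outsider `k`.
      have h1 : pOff (P.erase j) j ≤ pOff (insert j (P.erase j)) k := by
        rw [Finset.insert_erase hj]
        refine le_trans ?_ ((hI.offPrice_le j hj).trans (hI.le_offPrice k hkP))
        rw [offPrice, Finset.erase_idem, offPrice]
      have h2 := offPrice_insert_le_offPrice_insert (Finset.notMem_erase j P)
        (fun h => hkP (Finset.mem_of_mem_erase h)) hjk h1
      rw [Finset.insert_erase hj] at h2
      refine le_trans (le_of_eq ?_) h2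
      rw [offPrice, offPrice, Finset.erase_insert_of_ne hjk.symm, Finset.erase_insert_of_ne hjk.symm,
        Finset.erase_idem]
  · exact platformPrice_eq_of_mem hj (Finset.mem_insert_self k P)
  · have := mul_le_mul_of_nonneg_left (hon_le j hj) (sub_nonneg.2 hI.mem_Icc.2)
    have := hle_off j hj
    simp only [gain]
    linarith
  -- At a lower fee `k` is still a candidate and her gain is no smaller.
  · refine (hI.visits β hβ).tail ⟨k, ?_, hgain.trans (gain_anti hβ.2), rfl⟩
    exact (isCandidate_iff ⟨hβ.1, hβ.2.trans hI.mem_Icc.2⟩).2 ⟨hkP, hmin⟩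

theorem SweepReaches.exists_invariant (hs : SweepReaches (homogeneousValue w) g α P) :
    ∃ α₀ π q, SweepInvariant w g α P α₀ π q := by
  induction hs with
  | start => exact ⟨_, _, _, sweepInvariant_start w g⟩
  | lower _ h0 hle hneg ih =>
    obtain ⟨_, _, _, hI⟩ := ih
    exact ⟨_, _, _, hI.lower h0 hle hneg⟩
  | add _ hstep ih =>
    obtain ⟨_, _, _, hI⟩ := ih
    obtain ⟨k, hk, hgain, rfl⟩ := hstep
    exact ⟨_, _, _, hI.add hk hgain⟩

/-- Lowering the fee until a lowest priced seller is indifferent about joining. -/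
theorem SweepReaches.exists_gain_eq_zero (hs : SweepReaches (homogeneousValue w) g α P)
    (hk : k ∉ P) (hmin : ∀ j ∉ P, pOff P k ≤ pOff P j) :
    ∃ α' ∈ Set.Icc 0 α, SweepReaches (homogeneousValue w) g α' P ∧ pGain α' P k = 0 ∧
      ∀ β, α' < β → pGain β P k < 0 ∨ α < β := by
  obtain ⟨α₀, π, q, hI⟩ := hs.exists_invariant
  rcases (hI.gain_nonpos k hk).eq_or_lt with e | hlt
  · exact ⟨α, ⟨hI.mem_Icc.1, le_rfl⟩, hs, e, fun β hβ => .inr hβ⟩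
  have h0 := offPrice_nonneg (P := P) (j := k) (w := w) (g := g)
  have h1 := offPrice_le_onPrice (w := w) (g := g) hk
  have hon : 0 < pOn P k := by
    by_contra! h2
    have e1 : pOn P k = 0 := by linarith
    have e2 : pOff P k = 0 := by linarith
    simp [gain, e1, e2] at hlt
  have hroot : pOff P k / pOn P k * pOn P k = pOff P k := div_mul_cancel₀ _ hon.ne'
  have hle1 : pOff P k / pOn P k ≤ 1 := (div_le_one hon).2 h1
  have hleα : 1 - pOff P k / pOn P k ≤ α := by
    simp only [gain] at hlt
    nlinarith
  have hneg : ∀ β, 1 - pOff P k / pOn P k < β → pGain β P k < 0 := fun β hβ => by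
    simp only [gain]
    nlinarith
  -- This fee is the zero of the gain of `k`; above it her gain, the largest, is negative, so
  -- lowering is allowed.
  refine ⟨1 - pOff P k / pOn P k, ⟨by linarith, hleα⟩, hs.lower (by linarith) hleα
    fun β h2 h3 j hj => ?_, by simp only [gain]; linarith, fun β hβ => .inl (hneg β hβ)⟩
  exact (gain_le_gain_of_offPrice_le ⟨by linarith, h3.trans hI.mem_Icc.2⟩ hj hk
    (hmin j hj)).trans_lt (hneg β h2)

theorem SweepReaches.exists_candidate (hs : SweepReaches (homogeneousValue w) g α P)
    (hP : P ≠ Finset.univ) :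
    ∃ α' ∈ Set.Icc 0 α, SweepReaches (homogeneousValue w) g α' P ∧
      ∃ k, IsCandidate (homogeneousValue w) g α' P k ∧ pGain α' P k = 0 ∧
        SweepReaches (homogeneousValue w) g α' (insert k P) := by
  obtain ⟨k, hk, hmin⟩ := exists_lowest_offPrice w g hP
  obtain ⟨α', hα', hs', h0, -⟩ := hs.exists_gain_eq_zero hk hmin
  obtain ⟨_, _, _, hI⟩ := hs.exists_invariant
  have hc := (isCandidate_iff (w := w) (g := g) ⟨hα'.1, hα'.2.trans hI.mem_Icc.2⟩).2 ⟨hk, hmin⟩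
  exact ⟨α', hα', hs', k, hc, h0, hs'.add ⟨k, hc, h0.ge, rfl⟩⟩

theorem exists_sweepReaches_card (w : Buyer → ℝ) (g : Buyer → Seller → Prop) {n : ℕ}
    (hn : n ≤ Fintype.card Seller) :
    ∃ (α : ℝ) (P : Finset Seller), P.card = n ∧ SweepReaches (homogeneousValue w) g α P := by
  induction n with
  | zero => exact ⟨1, ∅, rfl, .start⟩
  | succ n ih =>
    obtain ⟨α, P, hc, hs⟩ := ih (by omega)
    have hP : P ≠ Finset.univ := by
      rintro rfl
      rw [Finset.card_univ] at hc
      omega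
    obtain ⟨α', -, -, k, hk, -, hs'⟩ := hs.exists_candidate hP
    exact ⟨α', insert k P, by rw [Finset.card_insert_of_notMem hk.1, hc], hs'⟩

/-- A sweep meets what the algorithm visits at a fixed fee, at a fee at least as high. -/
theorem AlgVisits.exists_sweepReaches (hα : α ∈ Set.Icc (0 : ℝ) 1)
    (hv : AlgVisits (homogeneousValue w) g α P) :
    ∃ β, α ≤ β ∧ SweepReaches (homogeneousValue w) g β P := by
  induction hv with
  | refl => exact ⟨1, hα.2, .start⟩
  | tail _ hstep ih =>
    obtain ⟨β, hβ, hs⟩ := ih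
    obtain ⟨k, hk, hgain, rfl⟩ := hstep
    obtain ⟨hkP, hmin⟩ := (isCandidate_iff hα).1 hk
    obtain ⟨α', hα', hs', h0, hneg⟩ := hs.exists_gain_eq_zero hkP hmin
    obtain ⟨_, _, _, hI⟩ := hs.exists_invariant
    refine ⟨α', ?_, hs'.add ⟨k, (isCandidate_iff ⟨hα'.1, hα'.2.trans hI.mem_Icc.2⟩).2 ⟨hkP, hmin⟩,
      h0.ge, rfl⟩⟩
    -- Were `α' < α`, the gain of `k` at `α` would be negative, although the algorithm adds her
    -- there.
    by_contra! hlt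
    rcases hneg α hlt with h | h <;> linarith

/-- Having stopped, the algorithm leaves only negative gains at `α`, hence at all higher fees, so
the sweep may come down to `α`. -/
theorem AlgOutputs.sweepReaches (hα : α ∈ Set.Icc (0 : ℝ) 1)
    (ho : AlgOutputs (homogeneousValue w) g α P) : SweepReaches (homogeneousValue w) g α P := by
  obtain ⟨β, hβ, hs⟩ := ho.1.exists_sweepReaches hα
  refine hs.lower hα.1 hβ fun γ h1 _ j hj => (gain_anti h1.le).trans_lt ?_
  obtain ⟨k, hk, hmin⟩ := exists_lowest_offPrice w g (P := P) (by rintro rfl; simp at hj)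
  refine (gain_le_gain_of_offPrice_le hα hj hk (hmin j hj)).trans_lt ?_
  by_contra! h
  exact ho.2 ⟨_, k, (isCandidate_iff hα).2 ⟨hk, hmin⟩, h, rfl⟩

end Sweep

end PlatformMarket

theorem mainTheorem8 {Buyer Seller : Type*} [Fintype Buyer] [Fintype Seller] [DecidableEq Seller]
    (g : Buyer → Seller → Prop) (w : Buyer → ℝ) (hw : ∀ i, 0 ≤ w i)
    (v : Buyer → Seller → ℝ) (hv : v = PlatformMarket.homogeneousValue w) :
    -- the maximum competitive prices exist, whichever sellers join
    (∀ P : Finset Seller,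
      IsGreatest {p | PlatformMarket.IsCompetitivePrice v (PlatformMarket.platformGraph g P) p}
        (PlatformMarket.platformPrice v g P)) ∧
    -- equilibria of every size exist, and are found by the sweep
    (∀ k : ℕ, 1 ≤ k → k ≤ Fintype.card Seller →
      ∃ α ∈ Set.Icc (0 : ℝ) 1, ∃ P : Finset Seller, P.card = k ∧
        PlatformMarket.IsPurePlatformEquilibrium v g α P ∧
        PlatformMarket.SweepReaches v g α P) ∧
    -- every set met by a sweep is an equilibrium at the current fee, and the algorithm at that
    -- fixed fee arrives at it, with no remaining seller having a positive gain
    (∀ (α : ℝ) (P : Finset Seller), PlatformMarket.SweepReaches v g α P →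
      PlatformMarket.IsPurePlatformEquilibrium v g α P ∧
      PlatformMarket.AlgVisits v g α P ∧
      ∀ j ∉ P, PlatformMarket.gain v g α P j ≤ 0) ∧
    -- a sweep never gets stuck: the fee is lowered until a largest gain is zero, and then
    -- one seller is added
    (∀ (α : ℝ) (P : Finset Seller), PlatformMarket.SweepReaches v g α P → P ≠ Finset.univ →
      ∃ α' ∈ Set.Icc (0 : ℝ) α, PlatformMarket.SweepReaches v g α' P ∧
        ∃ j, PlatformMarket.IsCandidate v g α' P j ∧ PlatformMarket.gain v g α' P j = 0 ∧
          PlatformMarket.SweepReaches v g α' (insert j P)) ∧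
    -- every output of the algorithm at a fixed fee is met by a sweep
    (∀ α ∈ Set.Icc (0 : ℝ) 1, ∀ P : Finset Seller, PlatformMarket.AlgOutputs v g α P →
      PlatformMarket.SweepReaches v g α P) := by
  subst hv
  refine ⟨fun P => PlatformMarket.isGreatest_maxPrice, fun k _ hk => ?_, fun α P hs => ?_,
    fun α P hs hP => hs.exists_candidate hP, fun α hα P ho => ho.sweepReaches hα⟩
  · obtain ⟨α, P, hc, hs⟩ := PlatformMarket.exists_sweepReaches_card w g hk
    obtain ⟨_, _, _, hI⟩ := hs.exists_invariant
    exact ⟨α, hI.mem_Icc, P, hc, hI.isPurePlatformEquilibrium, hs⟩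
  · obtain ⟨_, _, _, hI⟩ := hs.exists_invariant
    exact ⟨hI.isPurePlatformEquilibrium, hI.visits α ⟨hI.mem_Icc.1, le_rfl⟩, hI.gain_nonpos⟩
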